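/- Fix an integer $k \ge 1$. For a finite set $S$ of $n$ alternatives, let $2k-1$ voters choose rankings of $S$ independently and uniformly at random among all $n!$ rankings of $S$ (impartial culture). An alternative $A \in S$ is called a Condorcet winner if for every other alternative $B \in S$ at least $k$ of the $2k-1$ voters rank $A$ higher than $B$. Let $\sigma_k(x_1,\dots,x_{2k-1}) = \sum_{I \subseteq \{1,\dots,2k-1\},\, |I| = k} \prod_{i \in I} x_i$ be the $k$-th elementary symmetric polynomial and let $$C_k = \int_0^\infty \cdots \int_0^\infty \exp\bigl(-\sigma_k(x_1,\dots,x_{2k-1})\bigr)\, dx_1 \cdots dx_{2k-1}.$$ Then $0 < C_k < \infty$, and the probability that there is a Condorcet winner is $$C_k \cdot n^{-(k-1)/k} + O_k\!\left(\frac{(\ln n)^{1/k}}{n}\right);$$ that is, there is a constant $D_k > 0$, depending only on $k$, such that for all $n \ge 2$ this probability differs from $C_k \cdot n^{-(k-1)/k}$ by at most $D_k \cdot (\ln n)^{1/k}/n$ in absolute value. -/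

import Mathlib

open MeasureTheory ProbabilityTheory

noncomputable section

/-- A ranking of the finite set `S` of alternatives: a bijection that sends every alternative to
its position. Position `0` is the top of the ranking, so `A` is ranked higher than `B` in `r` when
`r A < r B`. -/
abbrev Ranking (S : Type*) [Fintype S] : Type _ := S ≃ Fin (Fintype.card S)

/-- Every set of rankings is an event. -/
instance Ranking.instMeasurableSpace (S : Type*) [Fintype S] : MeasurableSpace (Ranking S) := ⊤

/-- `A` is a Condorcet winner for the rankings `r` of `2k - 1` voters: for every other alternative
`B`, at least `k` of the voters rank `A` higher than `B`. -/
def IsCondorcetWinner {S : Type*} [Fintype S] (k : ℕ) (r : Fin (2 * k - 1) → Ranking S)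
    (A : S) : Prop :=
  ∀ B : S, B ≠ A → k ≤ (Finset.univ.filter fun i => r i A < r i B).card

/-- The impartial culture with `2k - 1` voters: the joint law of independent rankings, each of them
uniformly distributed on the set of all rankings of `S`. -/
def impartialCulture (k : ℕ) (S : Type*) [Fintype S] : Measure (Fin (2 * k - 1) → Ranking S) :=
  Measure.pi fun _ => uniformOn (Set.univ : Set (Ranking S))

/-- The function `x ↦ exp (- σ_k (x_1, …, x_{2k-1}))`, where `σ_k` is the `k`-th elementary
symmetric polynomial. -/
def expNegEsymm (k : ℕ) (x : Fin (2 * k - 1) → ℝ) : ℝ :=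
  Real.exp (-(MvPolynomial.eval x (MvPolynomial.esymm (Fin (2 * k - 1)) ℝ k)))

/-- The orthant `[0, ∞)^{2k-1}`. -/
def nonnegOrthant (k : ℕ) : Set (Fin (2 * k - 1) → ℝ) := {x | ∀ i, 0 ≤ x i}

/-- The constant `C_k`, the integral of `exp (- σ_k)` over `[0, ∞)^{2k-1}` against Lebesgue
measure. -/
def condorcetConstant (k : ℕ) : ℝ := ∫ x in nonnegOrthant k, expNegEsymm k x

end

/-! Uniform rankings come from independent uniform scores on `[0, 1]`, one for each voter and
alternative, a lower score being better. Let `A` have score vector `x` in the cube of dimension `2k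
- 1`. Another alternative `B` prevents `A` from winning exactly when at least `k` of its scores are
at most those of `A`; call the probability of this `q(x)` (`probLE`). Given `x`, the alternatives
other than `A` behave independently, and two Condorcet winners cannot coexist, so the probability
sought is exactly `n ∫ (1 - q)^(n-1)` over the cube (`impartialCulture_exists_isCondorcetWinner`).

Near the faces that matter, `q` is close to `σ_k`: binomial moments give `q ≤ σ_k ≤ c q` and `σ_k -
q = O(σ_{k+1})`, while `σ_{k+1} = O(σ_k^(1+1/k))`. Hence `(1 - q)^(n-1)` differs from `exp(-n σ_k)`
by `O(n^(-1/k)) exp(-c' n σ_k)` for some `c' > 0` (`abs_one_sub_probLE_pow_sub_exp_le`). By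
homogeneity the integral of `exp(-t σ_k)` over the orthant is `C_k t^(-(2k-1)/k)`
(`expLIntegral_eq`), so the pointwise error integrates to `O(n^(-2))`. The part of the orthant
outside the cube contributes `O(n^(-2))` as well (`exists_setLIntegral_tail_le`). Multiplying by `n`
leaves an error `O(1/n)`, stronger than the one claimed. -/

noncomputable section

/-! ### Inequalities for elementary symmetric polynomials -/

/-- The `k`-th elementary symmetric polynomial of the real numbers `x i`. -/
def elemSymm {ι : Type*} [Fintype ι] (k : ℕ) (x : ι → ℝ) : ℝ :=
  ∑ t ∈ Finset.univ.powersetCard k, ∏ i ∈ t, x i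

lemma eval_esymm_eq_elemSymm {ι : Type*} [Fintype ι] (k : ℕ) (x : ι → ℝ) :
    MvPolynomial.eval x (MvPolynomial.esymm ι ℝ k) = elemSymm k x := by
  simp [MvPolynomial.esymm, elemSymm, map_sum, map_prod]

section elemSymm
variable {ι : Type*} [Fintype ι]

lemma elemSymm_nonneg (k : ℕ) {x : ι → ℝ} (hx : ∀ i, 0 ≤ x i) : 0 ≤ elemSymm k x :=
  Finset.sum_nonneg fun _ _ => Finset.prod_nonneg fun i _ => hx i

lemma elemSymm_smul (k : ℕ) (c : ℝ) (x : ι → ℝ) :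
    elemSymm k (c • x) = c ^ k * elemSymm k x := by
  unfold elemSymm
  rw [Finset.mul_sum]
  refine Finset.sum_congr rfl fun t ht => ?_
  simp [Finset.prod_mul_distrib, (Finset.mem_powersetCard.1 ht).2]

lemma continuous_elemSymm (k : ℕ) : Continuous (elemSymm k : (ι → ℝ) → ℝ) := by
  unfold elemSymm
  fun_prop

lemma prod_le_elemSymm {k : ℕ} {x : ι → ℝ} (hx : ∀ i, 0 ≤ x i) {t : Finset ι}
    (ht : t.card = k) : ∏ i ∈ t, x i ≤ elemSymm k x :=
  Finset.single_le_sum (f := fun t => ∏ i ∈ t, x i)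
    (fun _ _ => Finset.prod_nonneg fun i _ => hx i)
    (Finset.mem_powersetCard.2 ⟨Finset.subset_univ _, ht⟩)

lemma elemSymm_one (x : ι → ℝ) : elemSymm 1 x = ∑ i, x i := by
  simp [elemSymm, Finset.powersetCard_one]

lemma elemSymm_zero (x : ι → ℝ) : elemSymm 0 x = 1 := by
  simp [elemSymm]

/-- Omit one factor at a time: each of the `k + 1` subproducts is a term of `σ_k`, and in their
product every `x i` occurs `k` times. -/
lemma pow_prod_le_elemSymm_pow {k : ℕ} {x : ι → ℝ} (hx : ∀ i, 0 ≤ x i) {t : Finset ι}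
    (ht : t.card = k + 1) : (∏ i ∈ t, x i) ^ k ≤ elemSymm k x ^ (k + 1) := by
  classical
  have h0 : 0 ≤ ∏ i ∈ t, x i := Finset.prod_nonneg fun i _ => hx i
  have hle : ∏ i ∈ t, ∏ j ∈ t.erase i, x j ≤ elemSymm k x ^ (k + 1) := by
    rw [← ht, ← Finset.prod_const]
    refine Finset.prod_le_prod (fun i _ => Finset.prod_nonneg fun j _ => hx j) fun i hi => ?_
    exact prod_le_elemSymm hx (by rw [Finset.card_erase_of_mem hi, ht]; simp)
  refine le_trans (le_of_eq ?_) hle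
  -- The identity is proved by cancelling the full product, so a vanishing product is treated apart,
  -- and there `k = 0` again because `0 ^ 0 = 1`.
  rcases h0.eq_or_lt with h | h
  · obtain ⟨i, hi, hi0⟩ := Finset.prod_eq_zero_iff.1 h.symm
    rcases Nat.eq_zero_or_pos k with rfl | hk
    · obtain ⟨a, rfl⟩ := Finset.card_eq_one.1 ht
      simp
    · rw [← h, zero_pow hk.ne']
      have : 1 < t.card := by omega
      obtain ⟨j, hj, hji⟩ := Finset.exists_mem_ne this i
      exact (Finset.prod_eq_zero hj (Finset.prod_eq_zero
        (Finset.mem_erase.2 ⟨hji.symm, hi⟩) hi0)).symm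
  · refine mul_left_cancel₀ h.ne' ?_
    rw [← pow_succ', ← ht, ← Finset.prod_const, ← Finset.prod_mul_distrib]
    exact Finset.prod_congr rfl fun i hi => (Finset.mul_prod_erase t x hi).symm

/-- Take `k`-th roots in `pow_prod_le_elemSymm_pow` and sum over the subsets. The gain `1 / k` in
the exponent becomes the factor `n^(-1/k)` of the error. -/
lemma elemSymm_succ_le_rpow {k : ℕ} (hk : 1 ≤ k) {x : ι → ℝ} (hx : ∀ i, 0 ≤ x i) :
    elemSymm (k + 1) x ≤
      (Fintype.card ι).choose (k + 1) * elemSymm k x ^ (1 + 1 / (k : ℝ)) := by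
  have hk' : (k : ℝ) ≠ 0 := by positivity
  have hE := elemSymm_nonneg k hx
  have : ∀ t ∈ (Finset.univ : Finset ι).powersetCard (k + 1),
      ∏ i ∈ t, x i ≤ elemSymm k x ^ (1 + 1 / (k : ℝ)) := by
    intro t ht
    have h := pow_prod_le_elemSymm_pow hx (Finset.mem_powersetCard.1 ht).2
    have h0 : 0 ≤ ∏ i ∈ t, x i := Finset.prod_nonneg fun i _ => hx i
    refine le_of_pow_le_pow_left₀ (n := k) (by omega) (by positivity) (h.trans (le_of_eq ?_))
    rw [← Real.rpow_mul_natCast hE, ← Real.rpow_natCast]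
    congr 1
    push_cast
    field_simp
  refine (Finset.sum_le_card_nsmul _ _ _ this).trans (le_of_eq ?_)
  simp [Finset.card_powersetCard]

end elemSymm

/-- The left side collects exactly the terms of `σ_{k+1}` whose index set contains `i`. This lowers
degree and dimension together. -/
lemma mul_elemSymm_removeNth_le {m : ℕ} (k : ℕ) (i : Fin (m + 1)) {x : Fin (m + 1) → ℝ}
    (hx : ∀ i, 0 ≤ x i) : x i * elemSymm k (i.removeNth x) ≤ elemSymm (k + 1) x := by
  classical
  have hni : ∀ t : Finset (Fin m), i ∉ t.map i.succAboveEmb := by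
    intro t h
    obtain ⟨j, -, hj⟩ := Finset.mem_map.1 h
    exact Fin.succAbove_ne i j hj
  unfold elemSymm
  rw [Finset.mul_sum]
  have hinj : Function.Injective
      fun t : Finset (Fin m) => insert i (t.map i.succAboveEmb) := by
    intro s t h
    have h' : (insert i (s.map i.succAboveEmb)).erase i
        = (insert i (t.map i.succAboveEmb)).erase i := congrArg (fun u => Finset.erase u i) h
    rw [Finset.erase_insert (hni s), Finset.erase_insert (hni t)] at h'
    exact Finset.map_injective _ h'
  have : ∑ t ∈ (Finset.univ : Finset (Fin m)).powersetCard k,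
        x i * ∏ j ∈ t, i.removeNth x j
      = ∑ u ∈ ((Finset.univ : Finset (Fin m)).powersetCard k).map ⟨_, hinj⟩,
        ∏ j ∈ u, x j := by
    rw [Finset.sum_map]
    refine Finset.sum_congr rfl fun t _ => ?_
    simp only [Function.Embedding.coeFn_mk]
    rw [Finset.prod_insert (hni t), Finset.prod_map]
    rfl
  rw [this]
  refine Finset.sum_le_sum_of_subset_of_nonneg ?_
    fun _ _ _ => Finset.prod_nonneg fun j _ => hx j
  intro u hu
  obtain ⟨t, ht, rfl⟩ := Finset.mem_map.1 hu
  refine Finset.mem_powersetCard.2 ⟨Finset.subset_univ _, ?_⟩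
  simp [Finset.card_insert_of_notMem (hni t), (Finset.mem_powersetCard.1 ht).2]

/-! ### Scaling, finiteness and tails of the integral of `exp(-t σ_k)` -/

/-- The integral of `exp (- t σ_k)` over the orthant `[0, ∞)^m`. -/
def expLIntegral (m k : ℕ) (t : ℝ) : ENNReal :=
  ∫⁻ x in Set.Ici (0 : Fin m → ℝ), ENNReal.ofReal (Real.exp (-(t * elemSymm k x)))

lemma measurable_exp_elemSymm {ι : Type*} [Fintype ι] (k : ℕ) (t : ℝ) :
    Measurable fun x : ι → ℝ => Real.exp (-(t * elemSymm k x)) := by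
  have := (continuous_elemSymm (ι := ι) k).measurable
  fun_prop

/-- Substitute `t^(1/k) x` for `x` and use homogeneity of degree `k`. Working in `ENNReal` allows
this before finiteness is known. -/
lemma expLIntegral_eq {m k : ℕ} (hk : 1 ≤ k) {t : ℝ} (ht : 0 < t) :
    expLIntegral m k t = ENNReal.ofReal (t ^ (-((m : ℝ) / k))) * expLIntegral m k 1 := by
  have hk' : (k : ℝ) ≠ 0 := by positivity
  set c : ℝ := t ^ (1 / (k : ℝ)) with hc
  have hc0 : 0 < c := Real.rpow_pos_of_pos ht _
  have hck : c ^ k = t := by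
    rw [hc, ← Real.rpow_natCast, ← Real.rpow_mul ht.le]; field_simp; simp
  have hcm : |(c ^ m)⁻¹| = t ^ (-((m : ℝ) / k)) := by
    rw [abs_of_pos (by positivity), hc, ← Real.rpow_mul_natCast ht.le, Real.rpow_neg ht.le]
    congr 2
    field_simp
  have hmap := Measure.map_addHaar_smul (volume : Measure (Fin m → ℝ)) hc0.ne'
  have hemb : MeasurableEmbedding (fun x : Fin m → ℝ => c • x) :=
    (Homeomorph.smulOfNeZero c hc0.ne').measurableEmbedding
  have hpre : (fun x : Fin m → ℝ => c • x) ⁻¹' Set.Ici 0 = Set.Ici 0 := by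
    ext x
    simp only [Set.mem_preimage, Set.mem_Ici, Pi.le_def, Pi.zero_apply, Pi.smul_apply, smul_eq_mul]
    exact forall_congr' fun i => mul_nonneg_iff_of_pos_left hc0
  have h1 : expLIntegral m k t = ∫⁻ x in Set.Ici (0 : Fin m → ℝ),
      ENNReal.ofReal (Real.exp (-(1 * elemSymm k x))) ∂(volume.map (fun x => c • x)) := by
    rw [hemb.restrict_map, hemb.lintegral_map, hpre]
    simp only [elemSymm_smul, hck, one_mul]
    rfl
  rw [h1, hmap, Measure.restrict_smul, lintegral_smul_measure, Module.finrank_fin_fun, hcm]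
  rfl

/-- Bound `σ_{k+1}(x)` below by `x i` times `σ_k` of the other coordinates, then integrate these
first by Tonelli, with `s = x i`. -/
lemma setLIntegral_exp_elemSymm_succ_le (m k : ℕ) (i : Fin (m + 1)) {t : ℝ} (ht : 0 ≤ t) :
    ∫⁻ x in Set.Ici (0 : Fin (m + 1) → ℝ) ∩ {x | 1 ≤ x i},
        ENNReal.ofReal (Real.exp (-(t * elemSymm (k + 1) x)))
      ≤ ∫⁻ s in Set.Ici (1 : ℝ), expLIntegral m k (t * s) := by
  have hS : Set.Ici (0 : Fin (m + 1) → ℝ) ∩ {x | 1 ≤ x i}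
      = MeasurableEquiv.piFinSuccAbove (fun _ => ℝ) i ⁻¹'
        (Set.Ici (1 : ℝ) ×ˢ Set.Ici (0 : Fin m → ℝ)) := by
    ext x
    simp only [Set.mem_inter_iff, Set.mem_Ici, Set.mem_ofPred_eq, Set.mem_preimage, Set.mem_prod,
      MeasurableEquiv.piFinSuccAbove_apply, Fin.insertNthEquiv_symm_apply, Pi.le_def,
      Pi.zero_apply]
    constructor
    · exact fun h => ⟨h.2, fun j => h.1 _⟩
    · refine fun h => ⟨fun j => ?_, h.1⟩
      rcases Fin.eq_self_or_eq_succAbove i j with rfl | ⟨l, rfl⟩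
      · exact zero_le_one.trans h.1
      · exact h.2 l
  have hmeas : MeasurableSet (Set.Ici (0 : Fin (m + 1) → ℝ) ∩ {x | 1 ≤ x i}) :=
    measurableSet_Ici.inter (measurableSet_le measurable_const (measurable_pi_apply i))
  calc _ ≤ ∫⁻ x in Set.Ici (0 : Fin (m + 1) → ℝ) ∩ {x | 1 ≤ x i},
        (fun p : ℝ × (Fin m → ℝ) => ENNReal.ofReal (Real.exp (-(t * p.1 * elemSymm k p.2))))
          (MeasurableEquiv.piFinSuccAbove (fun _ => ℝ) i x) := by
        refine setLIntegral_mono' hmeas fun x hx => ?_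
        refine ENNReal.ofReal_le_ofReal (Real.exp_le_exp.2 (neg_le_neg ?_))
        rw [mul_assoc]
        exact mul_le_mul_of_nonneg_left (mul_elemSymm_removeNth_le k i fun j => hx.1 j) ht
    _ = ∫⁻ p in Set.Ici (1 : ℝ) ×ˢ Set.Ici (0 : Fin m → ℝ),
        ENNReal.ofReal (Real.exp (-(t * p.1 * elemSymm k p.2))) := by
        rw [hS]
        exact (volume_preserving_piFinSuccAbove (fun _ => ℝ) i).setLIntegral_comp_preimage_emb
          (MeasurableEquiv.measurableEmbedding _)
          (fun p : ℝ × (Fin m → ℝ) => ENNReal.ofReal (Real.exp (-(t * p.1 * elemSymm k p.2))))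
          (Set.Ici (1 : ℝ) ×ˢ Set.Ici (0 : Fin m → ℝ))
    _ = _ := by
        rw [Measure.volume_eq_prod, ← Measure.prod_restrict, lintegral_prod]
        · rfl
        · have := (continuous_elemSymm (ι := Fin m) k).measurable
          fun_prop

lemma lintegral_Ici_one_rpow_lt_top {a : ℝ} (ha : a < -1) :
    ∫⁻ s in Set.Ici (1 : ℝ), ENNReal.ofReal (s ^ a) < ⊤ := by
  rw [setLIntegral_congr Ioi_ae_eq_Ici.symm]
  exact (integrableOn_Ioi_rpow_of_lt ha zero_lt_one).lintegral_lt_top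

lemma expLIntegral_one_one_lt_top (m : ℕ) : expLIntegral m 1 1 < ⊤ := by
  have h : Integrable (fun x : Fin m → ℝ => ∏ i, Real.exp (-x i))
      (Measure.pi fun _ => volume.restrict (Set.Ici 0)) := by
    refine Integrable.fintype_prod (f := fun _ s => Real.exp (-s)) fun i => ?_
    exact (integrableOn_Ici_iff_integrableOn_Ioi).2 (integrableOn_exp_neg_Ioi 0)
  rw [← Measure.restrict_pi_pi] at h
  have : (Set.univ.pi fun _ : Fin m => Set.Ici (0 : ℝ)) = Set.Ici 0 := by
    ext x; simp [Pi.le_def]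
  rw [this] at h
  have h2 := h.lintegral_lt_top
  unfold expLIntegral
  simpa [elemSymm_one, ← Finset.sum_neg_distrib, Real.exp_sum, volume_pi] using h2

lemma setLIntegral_tail_le {m k : ℕ} (hk : 1 ≤ k) (i : Fin (m + 1)) {t : ℝ} (ht : 0 < t) :
    ∫⁻ x in Set.Ici (0 : Fin (m + 1) → ℝ) ∩ {x | 1 ≤ x i},
        ENNReal.ofReal (Real.exp (-(t * elemSymm (k + 1) x)))
      ≤ ENNReal.ofReal (t ^ (-((m : ℝ) / k))) * expLIntegral m k 1 *
        ∫⁻ s in Set.Ici (1 : ℝ), ENNReal.ofReal (s ^ (-((m : ℝ) / k))) := by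
  refine (setLIntegral_exp_elemSymm_succ_le m k i ht.le).trans (le_of_eq ?_)
  rw [← lintegral_const_mul]
  · refine setLIntegral_congr_fun measurableSet_Ici fun s hs => ?_
    have hs0 : (0 : ℝ) < s := zero_lt_one.trans_le hs
    rw [expLIntegral_eq hk (mul_pos ht hs0), Real.mul_rpow ht.le hs0.le,
      ENNReal.ofReal_mul (by positivity)]
    ring
  · fun_prop

lemma Ici_zero_subset (m : ℕ) : Set.Ici (0 : Fin m → ℝ) ⊆
    Set.Icc 0 1 ∪ ⋃ i, (Set.Ici (0 : Fin m → ℝ) ∩ {x | 1 ≤ x i}) := by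
  intro x hx
  by_cases h : ∀ i, x i ≤ 1
  · exact Or.inl ⟨hx, h⟩
  · push Not at h
    obtain ⟨i, hi⟩ := h
    exact Or.inr (Set.mem_iUnion.2 ⟨i, hx, hi.le⟩)

/-- Finiteness holds when the number of variables exceeds the degree, here by `d + 1`, a gap that
the reduction to one variable fewer preserves. Outside the cube some coordinate is at least `1`, and
the tail is a multiple of the integral of `s^(-m/(k+1))` over `s ≥ 1`, which converges since `m > k
+ 1`. -/
lemma expLIntegral_one_lt_top (k d : ℕ) : expLIntegral (k + 1 + d + 1) (k + 1) 1 < ⊤ := by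
  induction k with
  | zero => exact expLIntegral_one_one_lt_top _
  | succ k ih =>
    rw [show k + 1 + 1 + d + 1 = (k + 1 + d + 1) + 1 by omega]
    set m := k + 1 + d + 1 with hm
    have hbase : ∫⁻ x in Set.Icc (0 : Fin (m + 1) → ℝ) 1,
        ENNReal.ofReal (Real.exp (-(1 * elemSymm (k + 1 + 1) x))) < ⊤ := by
      refine lt_of_le_of_lt (setLIntegral_mono' measurableSet_Icc (g := fun _ => 1)
        fun x hx => ?_) ?_
      · rw [ENNReal.ofReal_le_one, Real.exp_le_one_iff]
        have := elemSymm_nonneg (k + 1 + 1) (x := x) fun i => hx.1 i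
        linarith
      · simp [Real.volume_Icc_pi]
    have htail : ∀ i, ∫⁻ x in Set.Ici (0 : Fin (m + 1) → ℝ) ∩ {x | 1 ≤ x i},
        ENNReal.ofReal (Real.exp (-(1 * elemSymm (k + 1 + 1) x))) < ⊤ := by
      intro i
      refine lt_of_le_of_lt (setLIntegral_tail_le (by omega) i one_pos) ?_
      refine ENNReal.mul_lt_top (ENNReal.mul_lt_top ENNReal.ofReal_lt_top ih)
        (lintegral_Ici_one_rpow_lt_top ?_)
      rw [neg_lt_neg_iff, one_lt_div (by positivity), hm]
      push_cast
      have : (0 : ℝ) ≤ d := by positivity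
      linarith
    refine lt_of_le_of_lt (lintegral_mono_set (Ici_zero_subset (m + 1))) ?_
    refine lt_of_le_of_lt (lintegral_union_le _ _ _) (ENNReal.add_lt_top.2 ⟨hbase, ?_⟩)
    refine lt_of_le_of_lt (lintegral_iUnion_le _ _) ?_
    rw [tsum_fintype]
    exact ENNReal.sum_lt_top.2 fun i _ => htail i

/-- The part of the integral of `exp (- t σ_{k+1})` outside of the unit cube. -/
lemma exists_setLIntegral_tail_le (k : ℕ) : ∃ C : ℝ, 0 ≤ C ∧ ∀ t : ℝ, 0 < t →
    ∫⁻ x in Set.Ici (0 : Fin (2 * k + 1) → ℝ) \ Set.Icc 0 1,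
      ENNReal.ofReal (Real.exp (-(t * elemSymm (k + 1) x))) ≤ ENNReal.ofReal (C / t ^ 2) := by
  have key : ∃ C : ℝ, 0 ≤ C ∧ ∀ t : ℝ, 0 < t → ∀ i,
      ∫⁻ x in Set.Ici (0 : Fin (2 * k + 1) → ℝ) ∩ {x | 1 ≤ x i},
        ENNReal.ofReal (Real.exp (-(t * elemSymm (k + 1) x))) ≤ ENNReal.ofReal (C / t ^ 2) := by
    have hI : ∫⁻ s in Set.Ici (1 : ℝ), ENNReal.ofReal (s ^ (-2 : ℝ)) < ⊤ :=
      lintegral_Ici_one_rpow_lt_top (by norm_num)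
    set I := ∫⁻ s in Set.Ici (1 : ℝ), ENNReal.ofReal (s ^ (-2 : ℝ))
    -- Scaling divides by the degree `k` left after the reduction, so `k = 0` is separate: there the
    -- inner integral is at most `exp(-ts) ≤ 2 / (ts)^2`.
    rcases Nat.eq_zero_or_pos k with rfl | hk
    · refine ⟨2 * I.toReal, by positivity, fun t ht i => ?_⟩
      refine (setLIntegral_exp_elemSymm_succ_le 0 0 i ht.le).trans ?_
      calc _ ≤ ∫⁻ s in Set.Ici (1 : ℝ), ENNReal.ofReal (2 / t ^ 2) *
            ENNReal.ofReal (s ^ (-2 : ℝ)) := by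
            refine setLIntegral_mono' measurableSet_Ici fun s hs => ?_
            have hs0 : (0 : ℝ) < s := zero_lt_one.trans_le hs
            have hts : 0 < t * s := mul_pos ht hs0
            have hvol : (volume : Measure (Fin 0 → ℝ)) (Set.Ici 0) ≤ 1 := by
              refine (measure_mono (Set.subset_univ _)).trans ?_
              simp [volume_pi]
            simp only [expLIntegral, elemSymm_zero, mul_one, lintegral_const,
              Measure.restrict_apply MeasurableSet.univ, Set.univ_inter]
            refine (mul_le_mul_right hvol _).trans ?_
            rw [mul_one, ← ENNReal.ofReal_mul (by positivity)]
            refine ENNReal.ofReal_le_ofReal ?_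
            rw [Real.rpow_neg hs0.le, Real.exp_neg,
              show (s ^ (2 : ℝ)) = s ^ 2 from Real.rpow_natCast s 2]
            have := Real.quadratic_le_exp_of_nonneg hts.le
            rw [show 2 / t ^ 2 * (s ^ 2)⁻¹ = ((t * s) ^ 2 / 2)⁻¹ by field_simp]
            exact inv_anti₀ (by positivity) (by linarith)
        _ = _ := by
            rw [lintegral_const_mul _ (by fun_prop), mul_comm 2, mul_div_assoc,
              ENNReal.ofReal_mul ENNReal.toReal_nonneg, ENNReal.ofReal_toReal hI.ne, mul_comm]
    · have hJ : expLIntegral (2 * k) k 1 < ⊤ := by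
        obtain ⟨l, rfl⟩ : ∃ l, k = l + 1 := ⟨k - 1, by omega⟩
        rw [show 2 * (l + 1) = l + 1 + l + 1 by omega]
        exact expLIntegral_one_lt_top l l
      refine ⟨(expLIntegral (2 * k) k 1).toReal * I.toReal, by positivity, fun t ht i => ?_⟩
      refine (setLIntegral_tail_le hk i ht).trans (le_of_eq ?_)
      -- Removing one of the `2k + 1` variables leaves dimension `2k` and degree `k`, whence the
      -- decay `t^(-2)`.
      have he : -(((2 * k : ℕ) : ℝ) / k) = -2 := by
        have : (k : ℝ) ≠ 0 := by positivity
        push_cast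
        field_simp
      rw [he, div_eq_inv_mul, ENNReal.ofReal_mul (by positivity),
        ENNReal.ofReal_mul ENNReal.toReal_nonneg, ENNReal.ofReal_toReal hJ.ne,
        ENNReal.ofReal_toReal hI.ne, Real.rpow_neg ht.le,
        show (t ^ (2 : ℝ)) = t ^ 2 from Real.rpow_natCast t 2, mul_assoc]
  obtain ⟨C, hC, h⟩ := key
  refine ⟨(2 * k + 1 : ℕ) * C, by positivity, fun t ht => ?_⟩
  have hsub : Set.Ici (0 : Fin (2 * k + 1) → ℝ) \ Set.Icc 0 1 ⊆
      ⋃ i, (Set.Ici (0 : Fin (2 * k + 1) → ℝ) ∩ {x | 1 ≤ x i}) := by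
    rw [Set.sdiff_subset_iff]
    exact Ici_zero_subset _
  refine (lintegral_mono_set hsub).trans ((lintegral_iUnion_le _ _).trans ?_)
  rw [tsum_fintype]
  refine (Finset.sum_le_card_nsmul _ _ _ fun i _ => h t ht i).trans (le_of_eq ?_)
  rw [mul_div_assoc, ENNReal.ofReal_mul (by positivity), ENNReal.ofReal_natCast]
  simp

/-! ### Comparison of `(1 - q)^(n-1)` with `exp(-n s)` -/

lemma rpow_mul_exp_neg_le {u p b : ℝ} (hu : 0 ≤ u) (hp : 0 ≤ p) (hp2 : p ≤ 2) (hb : 0 < b) :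
    u ^ p * Real.exp (-(b * u)) ≤ (1 + 8 / b ^ 2) * Real.exp (-(b / 2 * u)) := by
  have h1 : u ^ p ≤ 1 + u ^ 2 := by
    rcases le_total u 1 with h | h
    · have := Real.rpow_le_one hu h hp
      nlinarith [sq_nonneg u]
    · have := Real.rpow_le_rpow_of_exponent_le h hp2
      rw [Real.rpow_two] at this
      linarith
  have hv : 0 ≤ b / 2 * u := by positivity
  have h2 := Real.quadratic_le_exp_of_nonneg hv
  have h3 : 1 + u ^ 2 ≤ (1 + 8 / b ^ 2) * Real.exp (b / 2 * u) := by
    have h4 : (1 : ℝ) ≤ Real.exp (b / 2 * u) := Real.one_le_exp hv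
    have h5 : u ^ 2 = 8 / b ^ 2 * ((b / 2 * u) ^ 2 / 2) := by field_simp; norm_num
    have h6 : 8 / b ^ 2 * ((b / 2 * u) ^ 2 / 2) ≤ 8 / b ^ 2 * Real.exp (b / 2 * u) :=
      mul_le_mul_of_nonneg_left (by linarith) (by positivity)
    linarith
  calc u ^ p * Real.exp (-(b * u))
      ≤ (1 + 8 / b ^ 2) * Real.exp (b / 2 * u) * Real.exp (-(b * u)) :=
        mul_le_mul_of_nonneg_right (h1.trans h3) (Real.exp_nonneg _)
    _ = _ := by
        rw [mul_assoc, ← Real.exp_add]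
        ring_nf

/-- Raise `exp(-s) (1 - s^2) ≤ 1 - s`, a form of `1 + s ≤ exp s`, to the power `n` and apply
Bernoulli. -/
lemma exp_neg_mul_one_sub_le_one_sub_pow (n : ℕ) {s : ℝ} (hs : 0 ≤ s) (hs1 : s ≤ 1) :
    Real.exp (-(n * s)) * (1 - n * s ^ 2) ≤ (1 - s) ^ n := by
  have h1 : Real.exp (-s) * (1 - s ^ 2) ≤ 1 - s := by
    rw [Real.exp_neg, inv_mul_le_iff₀ (Real.exp_pos s)]
    nlinarith [Real.add_one_le_exp s]
  have h2 : 1 + n * (-s ^ 2) ≤ (1 + -s ^ 2) ^ n :=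
    one_add_mul_le_pow (by nlinarith) n
  have h0 : 0 ≤ 1 - s ^ 2 := by nlinarith
  calc _ ≤ Real.exp (-(n * s)) * (1 - s ^ 2) ^ n := by
        refine mul_le_mul_of_nonneg_left ?_ (Real.exp_nonneg _)
        simpa [sub_eq_add_neg] using h2
    _ = (Real.exp (-s) * (1 - s ^ 2)) ^ n := by
        rw [mul_pow, ← Real.exp_nat_mul]
        ring_nf
    _ ≤ _ := pow_le_pow_left₀ (mul_nonneg (Real.exp_nonneg _) h0) h1 n

lemma inv_le_rpow_neg_one_div {k n : ℕ} (hk : 1 ≤ k) (hn : 1 ≤ n) :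
    (n : ℝ)⁻¹ ≤ (n : ℝ) ^ (-(1 / (k : ℝ))) := by
  rw [← Real.rpow_neg_one]
  refine Real.rpow_le_rpow_of_exponent_le (by exact_mod_cast hn) (neg_le_neg ?_)
  exact div_le_one_of_le₀ (by exact_mod_cast hk) (by positivity)

/-- The difference is at most `n s^2 exp(-ns)`, trivially so for `s > 1`. Since `n s^2 = (ns)^2 /
n`, half of the exponential absorbs the square; `9 = 1 + 8 / 1^2`. -/
lemma exp_neg_sub_one_sub_pow_le {n : ℕ} (hn : 1 ≤ n) {s q : ℝ} (hs : 0 ≤ s)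
    (hq0 : 0 ≤ q) (hq1 : q ≤ 1) (hqs : q ≤ s) :
    Real.exp (-(n * s)) - (1 - q) ^ (n - 1) ≤
      9 * ((n : ℝ)⁻¹ * Real.exp (-(1 / 2 * (n * s)))) := by
  have hn0 : (0 : ℝ) < n := by positivity
  have hn1 : (1 : ℝ) ≤ n := by exact_mod_cast hn
  have hns : 0 ≤ n * s := by positivity
  have h1 : Real.exp (-(n * s)) - (1 - q) ^ (n - 1) ≤ n * s ^ 2 * Real.exp (-(n * s)) := by
    rcases le_or_gt s 1 with h | h
    · have h2 := exp_neg_mul_one_sub_le_one_sub_pow n hs h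
      have h3 : (1 - s) ^ n ≤ (1 - q) ^ n := pow_le_pow_left₀ (by linarith) (by linarith) n
      have h4 : (1 - q) ^ n ≤ (1 - q) ^ (n - 1) :=
        pow_le_pow_of_le_one (by linarith) (by linarith) (by omega)
      linarith
    · have h2 : 0 ≤ (1 - q) ^ (n - 1) := pow_nonneg (by linarith) _
      have h3 : 1 ≤ n * s ^ 2 := one_le_mul_of_one_le_of_one_le hn1 (one_le_pow₀ h.le)
      have := le_mul_of_one_le_left (Real.exp_pos (-(n * s))).le h3
      linarith
  have h2 := rpow_mul_exp_neg_le hns zero_le_two le_rfl one_pos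
  rw [Real.rpow_two] at h2
  norm_num at h2
  calc _ ≤ n * s ^ 2 * Real.exp (-(n * s)) := h1
    _ = (n : ℝ)⁻¹ * ((n * s) ^ 2 * Real.exp (-(n * s))) := by field_simp
    _ ≤ (n : ℝ)⁻¹ * (9 * Real.exp (-(1 / 2 * (n * s)))) :=
        mul_le_mul_of_nonneg_left h2 (by positivity)
    _ = _ := by ring

/-- Passing from exponent `n - 1` to `n` costs a relative error of at most `q`, and `n - 1 ≥ n / 2`.
Absorbing `nq` gives `33 = 1 + 8 / (1/2)^2`. -/
lemma one_sub_pow_sub_exp_neg_le {n : ℕ} (hn : 2 ≤ n) {q : ℝ} (hq0 : 0 ≤ q) (hq1 : q ≤ 1) :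
    (1 - q) ^ (n - 1) - Real.exp (-(n * q)) ≤
      33 * ((n : ℝ)⁻¹ * Real.exp (-(1 / 4 * (n * q)))) := by
  have hn0 : (0 : ℝ) < n := by positivity
  have hn2 : (2 : ℝ) ≤ n := by exact_mod_cast hn
  have hnq : 0 ≤ n * q := by positivity
  have h1 : (1 - q) ^ (n - 1) ≤ Real.exp (-((n - 1) * q)) := by
    have := pow_le_pow_left₀ (by linarith) (Real.one_sub_le_exp_neg q) (n - 1)
    refine this.trans (le_of_eq ?_)
    rw [← Real.exp_nat_mul, Nat.cast_sub (by omega)]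
    push_cast
    ring_nf
  have h4 : Real.exp (-(n * q)) = Real.exp (-((n - 1) * q)) * Real.exp (-q) := by
    rw [← Real.exp_add]; ring_nf
  have h5 : Real.exp (-((n - 1) * q)) ≤ Real.exp (-(1 / 2 * (n * q))) := by
    refine Real.exp_le_exp.2 (neg_le_neg ?_)
    have : 0 ≤ (n - 2) * q := mul_nonneg (by linarith) hq0
    linarith
  have h3 : Real.exp (-((n - 1) * q)) - Real.exp (-(n * q)) ≤
      q * Real.exp (-(1 / 2 * (n * q))) := by
    rw [h4]
    calc _ = (1 - Real.exp (-q)) * Real.exp (-((n - 1) * q)) := by ring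
      _ ≤ _ := mul_le_mul (by linarith [Real.one_sub_le_exp_neg q]) h5 (Real.exp_nonneg _) hq0
  have h6 := rpow_mul_exp_neg_le hnq zero_le_one one_le_two (b := 1 / 2) (by norm_num)
  rw [Real.rpow_one] at h6
  norm_num at h6
  calc _ ≤ q * Real.exp (-(1 / 2 * (n * q))) := by linarith
    _ = (n : ℝ)⁻¹ * ((n * q) * Real.exp (-(1 / 2 * (n * q)))) := by field_simp
    _ ≤ (n : ℝ)⁻¹ * (33 * Real.exp (-(1 / 4 * (n * q)))) :=
        mul_le_mul_of_nonneg_left h6 (by positivity)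
    _ = _ := by ring

/-- The difference is at most `n (s - q) exp(-nq)`. Here `s ≤ c q` turns the decay into one in `s`,
and `n s^(1+1/k) = n^(-1/k) (ns)^(1+1/k)`, whose last factor the exponential absorbs. -/
lemma exp_neg_sub_exp_neg_le {k n : ℕ} (hk : 1 ≤ k) (hn : 1 ≤ n) {c c' s q : ℝ}
    (hc : 0 < c) (hc' : 0 ≤ c') (hs : 0 ≤ s) (hqs : q ≤ s)
    (hsq : s ≤ c * q) (hd : s - q ≤ c' * s ^ (1 + 1 / (k : ℝ))) :
    Real.exp (-(n * q)) - Real.exp (-(n * s)) ≤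
      c' * (1 + 8 * c ^ 2) *
        ((n : ℝ) ^ (-(1 / (k : ℝ))) * Real.exp (-(1 / c / 2 * (n * s)))) := by
  have hn0 : (0 : ℝ) < n := by positivity
  have hk0 : (0 : ℝ) < k := by exact_mod_cast hk
  have hns : 0 ≤ n * s := by positivity
  have h4 : Real.exp (-(n * q)) - Real.exp (-(n * s)) ≤
      n * (s - q) * Real.exp (-(1 / c * (n * s))) := by
    have h5 : Real.exp (-(n * s)) = Real.exp (-(n * q)) * Real.exp (-(n * (s - q))) := by
      rw [← Real.exp_add]; ring_nf
    have h8 : Real.exp (-(n * q)) ≤ Real.exp (-(1 / c * (n * s))) := by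
      refine Real.exp_le_exp.2 (neg_le_neg ?_)
      rw [one_div, inv_mul_le_iff₀ hc, mul_left_comm]
      exact mul_le_mul_of_nonneg_left hsq hn0.le
    have h9 : 0 ≤ n * (s - q) := mul_nonneg hn0.le (by linarith)
    rw [h5]
    calc _ = (1 - Real.exp (-(n * (s - q)))) * Real.exp (-(n * q)) := by ring
      _ ≤ _ := mul_le_mul (by linarith [Real.one_sub_le_exp_neg (n * (s - q))]) h8
        (Real.exp_nonneg _) h9
  have hk1 : 1 / (k : ℝ) ≤ 1 := div_le_one_of_le₀ (by exact_mod_cast hk) hk0.le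
  have hk2 : 0 ≤ 1 / (k : ℝ) := by positivity
  have h5 := rpow_mul_exp_neg_le hns (p := 1 + 1 / (k : ℝ)) (by linarith) (by linarith)
    (b := 1 / c) (by positivity)
  rw [show 8 / (1 / c) ^ 2 = 8 * c ^ 2 by field_simp] at h5
  have h7 : n * s ^ (1 + 1 / (k : ℝ)) =
      (n : ℝ) ^ (-(1 / (k : ℝ))) * (n * s) ^ (1 + 1 / (k : ℝ)) := by
    rw [Real.mul_rpow hn0.le hs, ← mul_assoc, ← Real.rpow_add hn0, neg_add_cancel_comm_assoc,
      Real.rpow_one]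
  calc _ ≤ n * (s - q) * Real.exp (-(1 / c * (n * s))) := h4
    _ ≤ n * (c' * s ^ (1 + 1 / (k : ℝ))) * Real.exp (-(1 / c * (n * s))) := by gcongr
    _ = c' * (n : ℝ) ^ (-(1 / (k : ℝ))) *
          ((n * s) ^ (1 + 1 / (k : ℝ)) * Real.exp (-(1 / c * (n * s)))) := by
        rw [mul_left_comm, h7]; ring
    _ ≤ c' * (n : ℝ) ^ (-(1 / (k : ℝ))) *
          ((1 + 8 * c ^ 2) * Real.exp (-(1 / c / 2 * (n * s)))) :=
        mul_le_mul_of_nonneg_left h5 (by positivity)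
    _ = _ := by ring

/-- The upper bound passes through `exp(-nq)`, the lower one is direct. The constant is the sum of
those of the three estimates, with `42 = 9 + 33`, and the rate `n / (4c)` is the slowest of their
decays. -/
lemma abs_one_sub_pow_sub_exp_le {k n : ℕ} (hk : 1 ≤ k) (hn : 2 ≤ n) {c c' s q : ℝ}
    (hc : 1 ≤ c) (hc' : 0 ≤ c') (hs : 0 ≤ s) (hq0 : 0 ≤ q) (hq1 : q ≤ 1) (hqs : q ≤ s)
    (hsq : s ≤ c * q) (hd : s - q ≤ c' * s ^ (1 + 1 / (k : ℝ))) :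
    |(1 - q) ^ (n - 1) - Real.exp (-(n * s))| ≤
      (42 + c' * (1 + 8 * c ^ 2)) * (n : ℝ) ^ (-(1 / (k : ℝ))) *
        Real.exp (-(n / (4 * c) * s)) := by
  have hn0 : (0 : ℝ) < n := by positivity
  have hc0 : 0 < c := by linarith
  have hr := inv_le_rpow_neg_one_div hk (show 1 ≤ n by omega)
  have h1 := exp_neg_sub_one_sub_pow_le (show 1 ≤ n by omega) hs hq0 hq1 hqs
  have h2 := one_sub_pow_sub_exp_neg_le hn hq0 hq1
  have h3 := exp_neg_sub_exp_neg_le hk (show 1 ≤ n by omega) hc0 hc' hs hqs hsq hd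
  have hc4 : n / (4 * c) * s = n * (s / c) / 4 := by field_simp
  have hns : 0 ≤ n * s := by positivity
  have hnsc : n * (s / c) ≤ n * s := mul_le_mul_of_nonneg_left (div_le_self hs hc) hn0.le
  have hnscq : n * (s / c) ≤ n * q :=
    mul_le_mul_of_nonneg_left (by rw [div_le_iff₀ hc0]; linarith) hn0.le
  have hnsc0 : 0 ≤ n * (s / c) := by positivity
  have e1 : Real.exp (-(1 / 2 * (n * s))) ≤ Real.exp (-(n / (4 * c) * s)) :=
    Real.exp_le_exp.2 (by rw [hc4]; linarith)
  have e2 : Real.exp (-(1 / 4 * (n * q))) ≤ Real.exp (-(n / (4 * c) * s)) :=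
    Real.exp_le_exp.2 (by rw [hc4]; linarith)
  have e3 : Real.exp (-(1 / c / 2 * (n * s))) ≤ Real.exp (-(n / (4 * c) * s)) :=
    Real.exp_le_exp.2 (by
      rw [hc4, show 1 / c / 2 * (n * s) = n * (s / c) / 2 by ring]; linarith)
  generalize Real.exp (-(n / (4 * c) * s)) = E at *
  generalize (n : ℝ) ^ (-(1 / (k : ℝ))) = r at *
  have hr0 : 0 ≤ r := le_trans (by positivity) hr
  have hE0 : 0 ≤ E := (Real.exp_nonneg _).trans e1
  have f1 := mul_le_mul hr e1 (Real.exp_nonneg _) hr0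
  have f2 := mul_le_mul hr e2 (Real.exp_nonneg _) hr0
  have f3 := mul_le_mul_of_nonneg_left (mul_le_mul_of_nonneg_left e3 hr0)
    (show 0 ≤ c' * (1 + 8 * c ^ 2) by positivity)
  have f4 : 0 ≤ c' * (1 + 8 * c ^ 2) * (r * E) := by positivity
  have f5 : 0 ≤ r * E := by positivity
  rw [show (42 + c' * (1 + 8 * c ^ 2)) * r * E
    = 42 * (r * E) + c' * (1 + 8 * c ^ 2) * (r * E) by ring, abs_le]
  constructor <;> linarith

/-! ### Binomial moments of a uniform point of the cube -/

/-- The uniform distribution on the unit interval. -/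
def unitUniform : Measure ℝ := volume.restrict (Set.Icc 0 1)

instance : IsProbabilityMeasure unitUniform := ⟨by simp [unitUniform]⟩

/-- The uniform distribution on the unit cube. -/
def cubeUniform (ι : Type*) [Fintype ι] : Measure (ι → ℝ) := Measure.pi fun _ => unitUniform

instance (ι : Type*) [Fintype ι] : IsProbabilityMeasure (cubeUniform ι) := by
  unfold cubeUniform; infer_instance

lemma cubeUniform_eq_restrict (ι : Type*) [Fintype ι] :
    cubeUniform ι = volume.restrict (Set.Icc 0 1) := by
  unfold cubeUniform unitUniform
  rw [← Measure.restrict_pi_pi, ← volume_pi]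
  congr 1
  ext x
  simp [Pi.le_def]

lemma measurableSet_forall_le {ι : Type*} (x : ι → ℝ) (t : Finset ι) :
    MeasurableSet {y : ι → ℝ | ∀ i ∈ t, y i ≤ x i} := by
  have : {y : ι → ℝ | ∀ i ∈ t, y i ≤ x i} = ⋂ i ∈ t, {y | y i ≤ x i} := by
    ext y; simp
  rw [this]
  exact Finset.measurableSet_biInter _ fun i _ =>
    measurableSet_le (measurable_pi_apply i) measurable_const

section
variable {ι : Type*} [Fintype ι]

/-- The number of coordinates of `y` that are at most the corresponding coordinates of `x`. -/
def numLE (x y : ι → ℝ) : ℕ := (Finset.univ.filter fun i => y i ≤ x i).card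

/-- The probability that at least `k` coordinates of a uniform random point of the unit cube are
at most the corresponding coordinates of `x`. -/
def probLE (k : ℕ) (x : ι → ℝ) : ℝ := (cubeUniform ι).real {y | k ≤ numLE x y}

lemma cubeUniform_real_pi {x : ι → ℝ} (hx : x ∈ Set.Icc (0 : ι → ℝ) 1) (t : Finset ι) :
    (cubeUniform ι).real {y | ∀ i ∈ t, y i ≤ x i} = ∏ i ∈ t, x i := by
  classical
  have : {y : ι → ℝ | ∀ i ∈ t, y i ≤ x i}
      = Set.univ.pi fun i => if i ∈ t then Set.Iic (x i) else Set.univ := by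
    ext y
    simp only [Set.mem_ofPred_eq, Set.mem_univ_pi]
    refine forall_congr' fun i => ?_
    by_cases h : i ∈ t <;> simp [h]
  rw [this, cubeUniform, Measure.real, Measure.pi_pi, ENNReal.toReal_prod,
    ← Finset.prod_subset (Finset.subset_univ t)]
  · refine Finset.prod_congr rfl fun i hi => ?_
    have h1 : Set.Iic (x i) ∩ Set.Icc 0 1 = Set.Icc 0 (x i) := by
      ext z
      have := hx.2 i
      simp only [Pi.one_apply] at this
      simp only [Set.mem_inter_iff, Set.mem_Iic, Set.mem_Icc]
      constructor
      · exact fun h => ⟨h.2.1, h.1⟩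
      · exact fun h => ⟨h.2, h.1, h.2.trans this⟩
    simp only [hi, if_true]
    rw [unitUniform, Measure.restrict_apply measurableSet_Iic, h1, Real.volume_Icc, sub_zero,
      ENNReal.toReal_ofReal (hx.1 i)]
  · intro i _ hi
    simp [hi]

/-- With `N = numLE x y`, `N.choose j` counts the `j`-sets of coordinates on which `y ≤ x`, so by
independence its mean is `σ_j(x)`. Bounds relating `probLE` to `σ_k` thus reduce to pointwise bounds
relating the indicator of `k ≤ N` to binomial coefficients. -/
lemma choose_numLE (j : ℕ) (x y : ι → ℝ) :
    ((numLE x y).choose j : ℝ) = ∑ t ∈ Finset.univ.powersetCard j,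
      {y : ι → ℝ | ∀ i ∈ t, y i ≤ x i}.indicator (fun _ => (1 : ℝ)) y := by
  classical
  unfold numLE
  rw [← Finset.card_powersetCard]
  simp only [Set.indicator_apply, Set.mem_ofPred_eq]
  rw [Finset.sum_boole]
  congr 2
  ext t
  simp only [Finset.mem_powersetCard, Finset.mem_filter, Finset.subset_univ, true_and]
  simp only [Finset.subset_iff, Finset.mem_filter, Finset.mem_univ, true_and]
  exact and_comm

lemma integrable_choose_numLE (j : ℕ) (x : ι → ℝ) :
    Integrable (fun y => ((numLE x y).choose j : ℝ)) (cubeUniform ι) := by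
  simp only [choose_numLE]
  exact integrable_finsetSum _ fun t _ =>
    (integrable_const _).indicator (measurableSet_forall_le x t)

lemma integral_choose_numLE (j : ℕ) {x : ι → ℝ} (hx : x ∈ Set.Icc (0 : ι → ℝ) 1) :
    ∫ y, ((numLE x y).choose j : ℝ) ∂(cubeUniform ι) = elemSymm j x := by
  simp only [choose_numLE]
  rw [integral_finsetSum _ fun t _ =>
    (integrable_const _).indicator (measurableSet_forall_le x t)]
  refine Finset.sum_congr rfl fun t _ => ?_
  rw [integral_indicator_const _ (measurableSet_forall_le x t), cubeUniform_real_pi hx]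
  simp

lemma measurable_uncurry_numLE :
    Measurable fun p : (ι → ℝ) × (ι → ℝ) => numLE p.1 p.2 := by
  classical
  have : (fun p : (ι → ℝ) × (ι → ℝ) => numLE p.1 p.2)
      = fun p => ∑ i, if p.2 i ≤ p.1 i then 1 else 0 := by
    ext p
    simp [numLE]
  rw [this]
  refine Finset.measurable_sum _ fun i _ => Measurable.ite ?_ measurable_const measurable_const
  exact measurableSet_le (by fun_prop) (by fun_prop)

lemma measurableSet_le_numLE (k : ℕ) (x : ι → ℝ) : MeasurableSet {y | k ≤ numLE x y} :=
  measurableSet_le measurable_const (measurable_uncurry_numLE.comp measurable_prodMk_left)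

lemma numLE_le_card (x y : ι → ℝ) : numLE x y ≤ Fintype.card ι := Finset.card_le_univ _

lemma integral_indicator_le_numLE (k : ℕ) (x : ι → ℝ) :
    ∫ y, {y | k ≤ numLE x y}.indicator (fun _ => (1 : ℝ)) y ∂(cubeUniform ι) = probLE k x := by
  rw [integral_indicator_const _ (measurableSet_le_numLE k x)]
  simp [probLE]

lemma integrable_indicator_le_numLE (k : ℕ) (x : ι → ℝ) :
    Integrable ({y | k ≤ numLE x y}.indicator fun _ => (1 : ℝ)) (cubeUniform ι) :=
  (integrable_const _).indicator (measurableSet_le_numLE k x)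

lemma probLE_le_elemSymm (k : ℕ) {x : ι → ℝ} (hx : x ∈ Set.Icc (0 : ι → ℝ) 1) :
    probLE k x ≤ elemSymm k x := by
  rw [← integral_choose_numLE k hx, ← integral_indicator_le_numLE]
  refine integral_mono (integrable_indicator_le_numLE k x) (integrable_choose_numLE k x)
    fun y => ?_
  by_cases h : k ≤ numLE x y
  · have : (1 : ℝ) ≤ (numLE x y).choose k := by exact_mod_cast Nat.choose_pos h
    simpa [h] using this
  · simp [h]

lemma choose_le_choose_card {k : ℕ} (x y : ι → ℝ) :
    ((numLE x y).choose k : ℝ) ≤ (Fintype.card ι).choose k := by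
  exact_mod_cast Nat.choose_le_choose k (numLE_le_card x y)

lemma elemSymm_le_mul_probLE (k : ℕ) {x : ι → ℝ} (hx : x ∈ Set.Icc (0 : ι → ℝ) 1) :
    elemSymm k x ≤ (Fintype.card ι).choose k * probLE k x := by
  rw [← integral_choose_numLE k hx, ← integral_indicator_le_numLE, ← integral_const_mul]
  refine integral_mono (integrable_choose_numLE k x)
    ((integrable_indicator_le_numLE k x).const_mul _) fun y => ?_
  by_cases h : k ≤ numLE x y
  · simpa [h] using choose_le_choose_card x y
  · simp [h, Nat.choose_eq_zero_of_lt (not_le.1 h)]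

/-- At `N = k` the coefficient `N.choose k` equals the indicator; for `N > k` it is at most `(card
ι).choose k`, and `N.choose (k + 1) ≥ 1`. -/
lemma elemSymm_sub_le_probLE (k : ℕ) {x : ι → ℝ} (hx : x ∈ Set.Icc (0 : ι → ℝ) 1) :
    elemSymm k x - probLE k x ≤ (Fintype.card ι).choose k * elemSymm (k + 1) x := by
  rw [sub_le_iff_le_add, ← integral_choose_numLE k hx, ← integral_choose_numLE (k + 1) hx,
    ← integral_indicator_le_numLE, ← integral_const_mul, ← integral_add
      ((integrable_choose_numLE _ x).const_mul _) (integrable_indicator_le_numLE k x)]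
  refine integral_mono (integrable_choose_numLE k x)
    (((integrable_choose_numLE _ x).const_mul _).add (integrable_indicator_le_numLE k x))
    fun y => ?_
  rcases lt_trichotomy (numLE x y) k with h | h | h
  · simp only [Nat.choose_eq_zero_of_lt h, Nat.cast_zero]
    exact add_nonneg (by positivity) (Set.indicator_nonneg (fun _ _ => zero_le_one) _)
  · simp [h]
  · have h1 : (1 : ℝ) ≤ (numLE x y).choose (k + 1) := by exact_mod_cast Nat.choose_pos h
    have h2 := choose_le_choose_card (k := k) x y
    have h3 : (0 : ℝ) ≤ {y | k ≤ numLE x y}.indicator (fun _ => (1 : ℝ)) y :=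
      Set.indicator_nonneg (fun _ _ => zero_le_one) _
    simp only
    nlinarith

lemma probLE_nonneg (k : ℕ) (x : ι → ℝ) : 0 ≤ probLE k x := measureReal_nonneg

lemma probLE_le_one (k : ℕ) (x : ι → ℝ) : probLE k x ≤ 1 := measureReal_le_one

lemma measurable_probLE (k : ℕ) : Measurable (probLE k : (ι → ℝ) → ℝ) := by
  have : MeasurableSet {p : (ι → ℝ) × (ι → ℝ) | k ≤ numLE p.1 p.2} :=
    measurableSet_le measurable_const measurable_uncurry_numLE
  exact (measurable_measure_prodMk_left (ν := cubeUniform ι) this).ennreal_toReal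

lemma abs_one_sub_probLE_pow_sub_exp_le {k n : ℕ} (hk : 1 ≤ k) (hkι : k ≤ Fintype.card ι)
    (hn : 2 ≤ n) {x : ι → ℝ} (hx : x ∈ Set.Icc (0 : ι → ℝ) 1) :
    |(1 - probLE k x) ^ (n - 1) - Real.exp (-(n * elemSymm k x))| ≤
      (42 + ((Fintype.card ι).choose k * (Fintype.card ι).choose (k + 1) : ℝ) *
          (1 + 8 * ((Fintype.card ι).choose k : ℝ) ^ 2)) * (n : ℝ) ^ (-(1 / (k : ℝ))) *
        Real.exp (-(n / (4 * (Fintype.card ι).choose k) * elemSymm k x)) := by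
  refine abs_one_sub_pow_sub_exp_le hk hn (by exact_mod_cast Nat.choose_pos hkι) (by positivity)
    (elemSymm_nonneg k hx.1) (probLE_nonneg k x) (probLE_le_one k x) (probLE_le_elemSymm k hx)
    (elemSymm_le_mul_probLE k hx) ((elemSymm_sub_le_probLE k hx).trans ?_)
  rw [mul_assoc]
  exact mul_le_mul_of_nonneg_left (elemSymm_succ_le_rpow hk hx.1) (by positivity)

end

/-! ### Rankings from independent uniform scores -/

section Ranking
variable {S : Type*} [Fintype S]

/-- The families of scores `u` that increase along the ranking `σ`. -/
def sortedBy (σ : Ranking S) : Set (S → ℝ) := {u | StrictMono (u ∘ σ.symm)}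

lemma lt_iff_lt_of_mem_sortedBy {σ : Ranking S} {u : S → ℝ} (h : u ∈ sortedBy σ) (a b : S) :
    σ a < σ b ↔ u a < u b := by
  have := StrictMono.lt_iff_lt h (a := σ a) (b := σ b)
  simpa using this.symm

/-- Two increasing enumerations of the same set of scores coincide. -/
lemma eq_of_mem_sortedBy {σ τ : Ranking S} {u : S → ℝ} (hσ : u ∈ sortedBy σ)
    (hτ : u ∈ sortedBy τ) : σ = τ := by
  have h : u ∘ σ.symm = u ∘ τ.symm := by
    refine StrictMono.range_inj hσ hτ |>.1 ?_
    simp [Set.range_comp]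
  have hu : Function.Injective u := by
    have := (StrictMono.injective hσ).comp σ.injective
    rwa [Function.comp_assoc, Equiv.symm_comp_self, Function.comp_id] at this
  have h2 : σ.symm = τ.symm := by
    ext i
    exact hu (congrFun h i)
  rw [← σ.symm_symm, h2, τ.symm_symm]

lemma exists_mem_sortedBy {u : S → ℝ} (hu : Function.Injective u) :
    ∃ σ : Ranking S, u ∈ sortedBy σ := by
  let _ : LinearOrder S := LinearOrder.lift' u hu
  let e := monoEquivOfFin S rfl
  refine ⟨e.symm.toEquiv, fun i j hij => ?_⟩
  exact e.strictMono hij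

open Classical in
/-- The ranking of the alternatives by increasing score (arbitrary if there are ties). -/
def rankingOf (u : S → ℝ) : Ranking S :=
  if h : ∃ σ, u ∈ sortedBy σ then h.choose else Fintype.equivFin S

lemma mem_sortedBy_rankingOf {u : S → ℝ} (hu : Function.Injective u) :
    u ∈ sortedBy (rankingOf u) := by
  have h := exists_mem_sortedBy hu
  rw [rankingOf, dif_pos h]
  exact h.choose_spec

lemma rankingOf_eq_iff {u : S → ℝ} (hu : Function.Injective u) (σ : Ranking S) :
    rankingOf u = σ ↔ u ∈ sortedBy σ :=
  ⟨fun h => h ▸ mem_sortedBy_rankingOf hu,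
    fun h => eq_of_mem_sortedBy (mem_sortedBy_rankingOf hu) h⟩

lemma measurableSet_strictMono (n : ℕ) : MeasurableSet {v : Fin n → ℝ | StrictMono v} := by
  have : {v : Fin n → ℝ | StrictMono v} = ⋂ (i) (j) (_ : i < j), {v | v i < v j} := by
    ext v
    simp only [Set.mem_ofPred_eq, Set.mem_iInter]
    exact ⟨fun h i j hij => h hij, fun h i j hij => h i j hij⟩
  rw [this]
  exact .iInter fun i => .iInter fun j => .iInter fun _ =>
    measurableSet_lt (measurable_pi_apply i) (measurable_pi_apply j)

lemma measurableSet_sortedBy (σ : Ranking S) : MeasurableSet (sortedBy σ) :=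
  (measurableSet_strictMono _).preimage (f := fun u : S → ℝ => u ∘ σ.symm)
    (measurable_pi_lambda _ fun i => measurable_pi_apply (σ.symm i))

/-- Permuting coordinates preserves the measure, so all rankings are equally likely. -/
lemma cubeUniform_sortedBy (σ : Ranking S) :
    cubeUniform S (sortedBy σ) =
      cubeUniform (Fin (Fintype.card S)) {v | StrictMono v} := by
  have h := (measurePreserving_piCongrLeft (fun _ : Fin (Fintype.card S) => unitUniform)
    σ).measure_preimage (measurableSet_strictMono _).nullMeasurableSet
  have h2 : MeasurableEquiv.piCongrLeft (fun _ : Fin (Fintype.card S) => ℝ) σ ⁻¹'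
      {v | StrictMono v} = sortedBy σ := by
    ext u
    have : MeasurableEquiv.piCongrLeft (fun _ : Fin (Fintype.card S) => ℝ) σ u
        = u ∘ σ.symm := by
      ext i
      simp [MeasurableEquiv.coe_piCongrLeft, Equiv.piCongrLeft_apply]
    simp only [Set.mem_preimage, this]
    rfl
  rw [h2] at h
  exact h

/-- Each possible tie confines `u` to a proper subspace, which is a null set. -/
lemma ae_injective : ∀ᵐ u ∂(cubeUniform S), Function.Injective u := by
  classical
  have h : ∀ a b : S, a ≠ b → ∀ᵐ u ∂(cubeUniform S), u a ≠ u b := by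
    intro a b hab
    rw [cubeUniform_eq_restrict]
    refine ae_restrict_of_ae ?_
    let p : Submodule ℝ (S → ℝ) :=
      LinearMap.ker (LinearMap.proj (R := ℝ) (φ := fun _ : S => ℝ) a - LinearMap.proj b)
    have hp : p ≠ ⊤ := by
      intro hp
      have : Pi.single a (1 : ℝ) ∈ p := hp ▸ Submodule.mem_top
      simp [p, hab] at this
    have := Measure.addHaar_submodule (volume : Measure (S → ℝ)) p hp
    rw [ae_iff]
    convert this using 2
    ext u
    simp [p, sub_eq_zero]
  have h2 : ∀ᵐ u ∂(cubeUniform S), ∀ a b : S, a ≠ b → u a ≠ u b := by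
    rw [ae_all_iff]; intro a
    rw [ae_all_iff]; intro b
    by_cases hab : a = b
    · simp [hab]
    · filter_upwards [h a b hab] with u hu _ using hu
  filter_upwards [h2] with u hu a b hab
  by_contra hne
  exact hu a b hne hab

lemma measurable_rankingOf : Measurable (rankingOf : (S → ℝ) → Ranking S) := by
  classical
  refine measurable_to_countable' fun σ => ?_
  have hE : MeasurableSet {u : S → ℝ | ∃ σ, u ∈ sortedBy σ} := by
    have : {u : S → ℝ | ∃ σ, u ∈ sortedBy σ} = ⋃ σ, sortedBy σ := by ext; simp
    rw [this]
    exact .iUnion measurableSet_sortedBy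
  have : rankingOf ⁻¹' {σ} = sortedBy σ ∪
      ({u : S → ℝ | ∃ σ, u ∈ sortedBy σ}ᶜ ∩ {_u | Fintype.equivFin S = σ}) := by
    ext u
    simp only [Set.mem_preimage, Set.mem_singleton_iff, Set.mem_union, Set.mem_inter_iff,
      Set.mem_compl_iff, Set.mem_ofPred_eq]
    by_cases h : ∃ σ, u ∈ sortedBy σ
    · rw [rankingOf, dif_pos h]
      constructor
      · exact fun h' => Or.inl (h' ▸ h.choose_spec)
      · rintro (h' | h')
        · exact eq_of_mem_sortedBy h.choose_spec h'
        · exact absurd h h'.1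
    · rw [rankingOf, dif_neg h]
      constructor
      · exact fun h' => Or.inr ⟨h, h'⟩
      · rintro (h' | h')
        · exact absurd ⟨σ, h'⟩ h
        · exact h'.2
  rw [this]
  exact (measurableSet_sortedBy σ).union (hE.compl.inter (.const _))

lemma map_rankingOf :
    (cubeUniform S).map rankingOf = uniformOn (Set.univ : Set (Ranking S)) := by
  classical
  set p := cubeUniform (Fin (Fintype.card S)) {v | StrictMono v} with hp
  have h1 : ∀ σ : Ranking S, (cubeUniform S).map rankingOf {σ} = p := by
    intro σ
    rw [Measure.map_apply measurable_rankingOf (measurableSet_singleton σ), hp,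
      ← cubeUniform_sortedBy σ]
    refine measure_congr ?_
    filter_upwards [ae_injective] with u hu
    exact propext (rankingOf_eq_iff hu σ)
  have : IsProbabilityMeasure ((cubeUniform S).map (rankingOf (S := S))) :=
    Measure.isProbabilityMeasure_map measurable_rankingOf.aemeasurable
  have h2 : (Fintype.card (Ranking S) : ENNReal) * p = 1 := by
    rw [← measure_univ (μ := (cubeUniform S).map (rankingOf (S := S))), ← Finset.coe_univ,
      ← sum_measure_singleton]
    simp [h1]
  refine Measure.ext_of_singleton fun σ => ?_
  rw [h1, uniformOn_univ, Measure.count_singleton]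
  have : Nonempty (Ranking S) := ⟨σ⟩
  rw [ENNReal.eq_div_iff (by simp [Nat.factorial_ne_zero]) (by simp), h2]

/-- The scores of the alternatives, `U i A` being the score that the voter `i` gives to `A`. -/
def scoreMeasure (ι S : Type*) [Fintype ι] [Fintype S] : Measure (ι → S → ℝ) :=
  Measure.pi fun _ => cubeUniform S

lemma impartialCulture_eq_map (k : ℕ) :
    impartialCulture k S = (scoreMeasure (Fin (2 * k - 1)) S).map fun U i => rankingOf (U i) := by
  have : IsProbabilityMeasure ((cubeUniform S).map (rankingOf (S := S))) :=
    Measure.isProbabilityMeasure_map measurable_rankingOf.aemeasurable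
  rw [scoreMeasure, Measure.pi_map_pi fun _ => measurable_rankingOf.aemeasurable, map_rankingOf]
  rfl

lemma measurePreserving_curry_scoreMeasure (ι S : Type*) [Fintype ι] [Fintype S] :
    MeasurePreserving (MeasurableEquiv.curry ι S ℝ)
      (Measure.pi fun _ : ι × S => unitUniform) (scoreMeasure ι S) := by
  refine ⟨MeasurableEquiv.measurable _, ?_⟩
  have := Measure.infinitePi_map_curry (fun (_ : ι) (_ : S) => unitUniform)
  simp only [Measure.infinitePi_eq_pi] at this
  exact this

/-- Rankings need the scores grouped by voter, conditioning on a candidate needs them grouped by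
alternative; both are curryings of one product over pairs. -/
lemma measurePreserving_transpose (ι S : Type*) [Fintype ι] [Fintype S] :
    MeasurePreserving (fun (U : ι → S → ℝ) s i => U i s) (scoreMeasure ι S)
      (scoreMeasure S ι) := by
  have h1 := (measurePreserving_curry_scoreMeasure ι S).symm
  have h2 := measurePreserving_piCongrLeft (fun _ : S × ι => unitUniform) (Equiv.prodComm ι S)
  have h3 := measurePreserving_curry_scoreMeasure S ι
  convert h3.comp (h2.comp h1) using 1
  ext U s i
  have := Equiv.piCongrLeft_apply_apply (fun _ : S × ι => ℝ) (Equiv.prodComm ι S)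
    ((MeasurableEquiv.curry ι S ℝ).symm U) (i, s)
  simp only [Equiv.prodComm_apply, Prod.swap_prod_mk] at this
  exact this.symm

instance (ι S : Type*) [Fintype ι] [Fintype S] : IsProbabilityMeasure (scoreMeasure ι S) := by
  unfold scoreMeasure; infer_instance

/-- The score families for which at least `k` of the voters prefer `A` to any other alternative. -/
def scoreWinner {ι : Type*} [Fintype ι] (k : ℕ) (A : S) : Set (S → ι → ℝ) :=
  {X | ∀ B, B ≠ A → k ≤ (Finset.univ.filter fun i => X A i < X B i).card}

lemma card_filter_lt_add_numLE {ι : Type*} [Fintype ι] (x y : ι → ℝ) :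
    (Finset.univ.filter fun i => x i < y i).card + numLE x y = Fintype.card ι := by
  classical
  rw [numLE, ← Finset.card_univ,
    ← Finset.card_filter_add_card_filter_not (s := Finset.univ) fun i => x i < y i]
  simp only [not_lt]

/-- Among `2k - 1` coordinates, either at least `k` satisfy `x i < y i` or at least `k` satisfy `y i
≤ x i`, never both. -/
lemma cubeUniform_setOf_le_card_lt {k : ℕ} (hk : 1 ≤ k) (x : Fin (2 * k - 1) → ℝ) :
    cubeUniform (Fin (2 * k - 1)) {y | k ≤ (Finset.univ.filter fun i => x i < y i).card}
      = ENNReal.ofReal (1 - probLE k x) := by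
  have : {y : Fin (2 * k - 1) → ℝ | k ≤ (Finset.univ.filter fun i => x i < y i).card}
      = {y | k ≤ numLE x y}ᶜ := by
    ext y
    have := card_filter_lt_add_numLE x y
    rw [Fintype.card_fin] at this
    simp only [Set.mem_ofPred_eq, Set.mem_compl_iff]
    omega
  rw [this, probLE, ← probReal_compl_eq_one_sub (measurableSet_le_numLE k x),
    ofReal_measureReal]

lemma measurableSet_le_card_lt {α ι : Type*} [MeasurableSpace α] [Fintype ι] (k : ℕ)
    {f g : α → ι → ℝ} (hf : Measurable f) (hg : Measurable g) :
    MeasurableSet {a | k ≤ (Finset.univ.filter fun i => f a i < g a i).card} := by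
  have h : {a | k ≤ (Finset.univ.filter fun i => f a i < g a i).card}
      = {a | k ≤ Fintype.card ι - numLE (f a) (g a)} := by
    ext a
    have := card_filter_lt_add_numLE (f a) (g a)
    simp only [Set.mem_ofPred_eq]
    rw [← this, Nat.add_sub_cancel]
  rw [h]
  exact measurableSet_le measurable_const
    ((measurable_from_top (f := fun j : ℕ => Fintype.card ι - j)).comp
      (measurable_uncurry_numLE.comp (hf.prodMk hg)))

lemma measurableSet_scoreWinner {ι : Type*} [Fintype ι] (k : ℕ) (A : S) :
    MeasurableSet (scoreWinner (ι := ι) k A) := by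
  have : scoreWinner (ι := ι) k A = ⋂ (B) (_ : B ≠ A),
      {X | k ≤ (Finset.univ.filter fun i => X A i < X B i).card} := by
    ext X; simp [scoreWinner]
  rw [this]
  exact .iInter fun B => .iInter fun _ =>
    measurableSet_le_card_lt k (measurable_pi_apply A) (measurable_pi_apply B)

/-- Condition on the scores `x` of `A`: the other score vectors are independent, and each loses to
`A` with probability `1 - probLE k x`. -/
lemma scoreMeasure_scoreWinner {k : ℕ} (hk : 1 ≤ k) (A : S) :
    scoreMeasure S (Fin (2 * k - 1)) (scoreWinner k A) =
      ∫⁻ x, ENNReal.ofReal ((1 - probLE k x) ^ (Fintype.card S - 1))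
        ∂(cubeUniform (Fin (2 * k - 1))) := by
  classical
  set μ := cubeUniform (Fin (2 * k - 1)) with hμ
  -- The event is rewritten on the product of the coordinate `A` and all the others, so that Fubini
  -- applies.
  let F : Set (({B : S // B = A} → Fin (2 * k - 1) → ℝ) ×
      ({B : S // ¬ B = A} → Fin (2 * k - 1) → ℝ)) :=
    {p | ∀ B, k ≤ (Finset.univ.filter fun i => p.1 ⟨A, rfl⟩ i < p.2 B i).card}
  have hF : MeasurableSet F := by
    have : F = ⋂ B, {p | k ≤ (Finset.univ.filter fun i => p.1 ⟨A, rfl⟩ i < p.2 B i).card} := by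
      ext p; simp [F]
    rw [this]
    exact .iInter fun B => measurableSet_le_card_lt k (by fun_prop) (by fun_prop)
  have h1 := (measurePreserving_piEquivPiSubtypeProd (fun _ : S => μ)
    (fun B => B = A)).measure_preimage hF.nullMeasurableSet
  have h2 : MeasurableEquiv.piEquivPiSubtypeProd (fun _ : S => Fin (2 * k - 1) → ℝ)
      (fun B => B = A) ⁻¹' F = scoreWinner k A := by
    ext X
    exact ⟨fun h B hB => h ⟨B, hB⟩, fun h B => h B.1 B.2⟩
  rw [h2] at h1
  refine h1.trans ?_
  rw [Measure.prod_apply hF]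
  have h3 : ∀ f : {B : S // B = A} → Fin (2 * k - 1) → ℝ,
      (Measure.pi fun _ : {B : S // ¬ B = A} => μ) (Prod.mk f ⁻¹' F)
        = ENNReal.ofReal ((1 - probLE k (f ⟨A, rfl⟩)) ^ (Fintype.card S - 1)) := by
    intro f
    have : Prod.mk f ⁻¹' F = Set.univ.pi fun _ =>
        {y | k ≤ (Finset.univ.filter fun i => f ⟨A, rfl⟩ i < y i).card} := by
      ext g; simp [F]
    rw [this, Measure.pi_pi]
    simp only [hμ, cubeUniform_setOf_le_card_lt hk, Finset.prod_const, Finset.card_univ]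
    rw [ENNReal.ofReal_pow (sub_nonneg.2 (probLE_le_one k _)), Fintype.card_subtype_compl,
      Fintype.card_subtype_eq]
  simp only [h3]
  have hmeas : Measurable fun x : Fin (2 * k - 1) → ℝ =>
      ENNReal.ofReal ((1 - probLE k x) ^ (Fintype.card S - 1)) := by
    have := measurable_probLE (ι := Fin (2 * k - 1)) k
    fun_prop
  convert (measurePreserving_eval (fun _ : {B : S // B = A} => μ) ⟨A, rfl⟩).lintegral_comp hmeas

lemma not_le_card_of_le_card_lt {k : ℕ} (hk : 1 ≤ k) {x y : Fin (2 * k - 1) → ℝ}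
    (h : k ≤ (Finset.univ.filter fun i => x i < y i).card) :
    ¬ k ≤ (Finset.univ.filter fun i => y i < x i).card := by
  have h1 := card_filter_lt_add_numLE x y
  have h2 : (Finset.univ.filter fun i => y i < x i).card ≤ numLE x y :=
    Finset.card_le_card fun i hi => by
      simp only [Finset.mem_filter, Finset.mem_univ, true_and] at hi ⊢
      exact hi.le
  rw [Fintype.card_fin] at h1
  omega

lemma isCondorcetWinner_rankingOf_iff {k : ℕ} {U : Fin (2 * k - 1) → S → ℝ}
    (hU : ∀ i, Function.Injective (U i)) (A : S) :
    IsCondorcetWinner k (fun i => rankingOf (U i)) A ↔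
      (fun s i => U i s) ∈ scoreWinner k A := by
  simp only [IsCondorcetWinner, scoreWinner, Set.mem_ofPred_eq,
    fun i => lt_iff_lt_of_mem_sortedBy (mem_sortedBy_rankingOf (hU i))]

/-- The probability of a Condorcet winner as an integral over the scores of the winner. -/
lemma impartialCulture_exists_isCondorcetWinner {k : ℕ} (hk : 1 ≤ k) :
    (impartialCulture k S).real {r | ∃ A : S, IsCondorcetWinner k r A} =
      Fintype.card S * ∫ x in Set.Icc (0 : Fin (2 * k - 1) → ℝ) 1,
        (1 - probLE k x) ^ (Fintype.card S - 1) := by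
  have hmeas : Measurable fun (U : Fin (2 * k - 1) → S → ℝ) i => rankingOf (U i) :=
    measurable_pi_lambda _ fun i => measurable_rankingOf.comp (measurable_pi_apply i)
  have hae : ∀ᵐ U ∂(scoreMeasure (Fin (2 * k - 1)) S), ∀ i, Function.Injective (U i) := by
    rw [ae_all_iff]
    intro i
    exact (measurePreserving_eval (fun _ : Fin (2 * k - 1) => cubeUniform S)
      i).quasiMeasurePreserving.ae ae_injective
  have h1 : impartialCulture k S {r | ∃ A : S, IsCondorcetWinner k r A} =
      scoreMeasure S (Fin (2 * k - 1)) (⋃ A, scoreWinner k A) := by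
    rw [impartialCulture_eq_map, Measure.map_apply hmeas (Set.toFinite _).measurableSet,
      ← (measurePreserving_transpose (Fin (2 * k - 1)) S).measure_preimage
        (MeasurableSet.iUnion fun A => measurableSet_scoreWinner k A).nullMeasurableSet]
    refine measure_congr ?_
    filter_upwards [hae] with U hU
    refine propext ?_
    change (∃ A, IsCondorcetWinner k (fun i => rankingOf (U i)) A) ↔
      (fun s i => U i s) ∈ ⋃ A, scoreWinner k A
    rw [Set.mem_iUnion]
    exact exists_congr fun A => isCondorcetWinner_rankingOf_iff hU A
  -- Two alternatives cannot each beat the other by a majority, so the probabilities of winning add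
  -- up.
  have hdisj : Pairwise (Function.onFun Disjoint
      fun A : S => scoreWinner (ι := Fin (2 * k - 1)) k A) := by
    intro A B hAB
    refine Set.disjoint_left.2 fun X hA hB => ?_
    exact not_le_card_of_le_card_lt hk (hA B hAB.symm) (hB A hAB)
  have hq := measurable_probLE (ι := Fin (2 * k - 1)) k
  rw [Measure.real, h1, measure_iUnion hdisj fun A => measurableSet_scoreWinner k A, tsum_fintype]
  simp only [scoreMeasure_scoreWinner hk, Finset.sum_const, Finset.card_univ, nsmul_eq_mul]
  rw [ENNReal.toReal_mul, ENNReal.toReal_natCast, ← cubeUniform_eq_restrict,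
    integral_eq_lintegral_of_nonneg_ae]
  · exact Filter.Eventually.of_forall fun x =>
      pow_nonneg (sub_nonneg.2 (probLE_le_one k x)) _
  · exact ((measurable_const.sub hq).pow_const _).aestronglyMeasurable

end Ranking

end

/-! ### The constant `C_k` and the final estimate -/

lemma nonnegOrthant_eq_Ici (k : ℕ) : nonnegOrthant k = Set.Ici 0 := rfl

lemma expNegEsymm_eq (k : ℕ) (x : Fin (2 * k - 1) → ℝ) :
    expNegEsymm k x = Real.exp (-(1 * elemSymm k x)) := by
  rw [expNegEsymm, eval_esymm_eq_elemSymm, one_mul]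

lemma expLIntegral_lt_top {k : ℕ} (hk : 1 ≤ k) {t : ℝ} (ht : 0 < t) :
    expLIntegral (2 * k - 1) k t < ⊤ := by
  rw [expLIntegral_eq hk ht]
  refine ENNReal.mul_lt_top ENNReal.ofReal_lt_top ?_
  obtain ⟨l, rfl⟩ : ∃ l, k = l + 1 := ⟨k - 1, by omega⟩
  rcases Nat.eq_zero_or_pos l with rfl | hl
  · exact expLIntegral_one_one_lt_top _
  · rw [show 2 * (l + 1) - 1 = l + 1 + (l - 1) + 1 by omega]
    exact expLIntegral_one_lt_top l (l - 1)

lemma integrableOn_exp_elemSymm {k : ℕ} (hk : 1 ≤ k) {t : ℝ} (ht : 0 < t) :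
    IntegrableOn (fun x : Fin (2 * k - 1) → ℝ => Real.exp (-(t * elemSymm k x)))
      (Set.Ici 0) volume := by
  refine ⟨(measurable_exp_elemSymm k t).aestronglyMeasurable, ?_⟩
  rw [hasFiniteIntegral_iff_ofReal (Filter.Eventually.of_forall fun x => Real.exp_nonneg _)]
  exact expLIntegral_lt_top hk ht

lemma setIntegral_exp_elemSymm (m k : ℕ) (t : ℝ) :
    ∫ x in Set.Ici (0 : Fin m → ℝ), Real.exp (-(t * elemSymm k x))
      = (expLIntegral m k t).toReal :=
  integral_eq_lintegral_of_nonneg_ae (Filter.Eventually.of_forall fun _ => Real.exp_nonneg _)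
    (measurable_exp_elemSymm k t).aestronglyMeasurable

lemma condorcetConstant_eq (k : ℕ) :
    condorcetConstant k = (expLIntegral (2 * k - 1) k 1).toReal := by
  rw [← setIntegral_exp_elemSymm]
  simp only [condorcetConstant, nonnegOrthant_eq_Ici, expNegEsymm_eq]

lemma setIntegral_exp_elemSymm_eq {k : ℕ} (hk : 1 ≤ k) {t : ℝ} (ht : 0 < t) :
    ∫ x in Set.Ici (0 : Fin (2 * k - 1) → ℝ), Real.exp (-(t * elemSymm k x))
      = t ^ (-(((2 * k - 1 : ℕ) : ℝ) / k)) * condorcetConstant k := by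
  rw [setIntegral_exp_elemSymm, expLIntegral_eq hk ht, ENNReal.toReal_mul,
    ENNReal.toReal_ofReal (by positivity), condorcetConstant_eq]

lemma integrableOn_expNegEsymm {k : ℕ} (hk : 1 ≤ k) :
    IntegrableOn (expNegEsymm k) (nonnegOrthant k) volume := by
  have := integrableOn_exp_elemSymm hk one_pos
  simpa only [nonnegOrthant_eq_Ici, ← expNegEsymm_eq] using this

lemma condorcetConstant_pos {k : ℕ} (hk : 1 ≤ k) : 0 < condorcetConstant k := by
  have h := integrableOn_expNegEsymm hk
  rw [condorcetConstant, setIntegral_pos_iff_support_of_nonneg_ae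
    (f := expNegEsymm k) (Filter.Eventually.of_forall fun x => Real.exp_nonneg _) h]
  have hs : Function.support (expNegEsymm k) = Set.univ := by
    ext x; simp [expNegEsymm]
  rw [hs, Set.univ_inter]
  refine lt_of_lt_of_le ?_ (measure_mono (s := Set.Icc 0 1) fun x hx => hx.1)
  simp [Real.volume_Icc_pi]

lemma exists_setIntegral_tail_le {k : ℕ} (hk : 1 ≤ k) : ∃ C : ℝ, 0 ≤ C ∧ ∀ t : ℝ, 0 < t →
    ∫ x in Set.Ici (0 : Fin (2 * k - 1) → ℝ) \ Set.Icc 0 1,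
      Real.exp (-(t * elemSymm k x)) ≤ C / t ^ 2 := by
  obtain ⟨l, rfl⟩ : ∃ l, k = l + 1 := ⟨k - 1, by omega⟩
  obtain ⟨C, hC, h⟩ := exists_setLIntegral_tail_le l
  refine ⟨C, hC, fun t ht => ?_⟩
  rw [show 2 * (l + 1) - 1 = 2 * l + 1 by omega]
  rw [integral_eq_lintegral_of_nonneg_ae (Filter.Eventually.of_forall fun _ => Real.exp_nonneg _)
    (measurable_exp_elemSymm (l + 1) t).aestronglyMeasurable]
  exact ENNReal.toReal_le_of_le_ofReal (by positivity) (h t ht)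

/-- The error has two sources: the pointwise error on the cube, bounded by its integral over the
whole orthant, and the tail of `exp(-n σ_k)` outside the cube. -/
lemma exists_abs_setIntegral_one_sub_probLE_pow_sub_le {k : ℕ} (hk : 1 ≤ k) :
    ∃ M : ℝ, 0 ≤ M ∧ ∀ n : ℕ, 2 ≤ n →
      |(∫ x in Set.Icc (0 : Fin (2 * k - 1) → ℝ) 1, (1 - probLE k x) ^ (n - 1))
          - ∫ x in Set.Ici (0 : Fin (2 * k - 1) → ℝ), Real.exp (-(n * elemSymm k x))|
        ≤ M / (n : ℝ) ^ 2 := by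
  obtain ⟨C, hC, htail⟩ := exists_setIntegral_tail_le hk
  have hk0 : (k : ℝ) ≠ 0 := by positivity
  have hcard : Fintype.card (Fin (2 * k - 1)) = 2 * k - 1 := Fintype.card_fin _
  have hkm : k ≤ Fintype.card (Fin (2 * k - 1)) := by omega
  have hpt := fun (n : ℕ) (hn : 2 ≤ n) (x : Fin (2 * k - 1) → ℝ) hx =>
    abs_one_sub_probLE_pow_sub_exp_le (n := n) hk hkm hn (x := x) hx
  have hc : (0 : ℝ) < (Fintype.card (Fin (2 * k - 1))).choose k := by
    exact_mod_cast Nat.choose_pos hkm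
  set c : ℝ := (((Fintype.card (Fin (2 * k - 1))).choose k : ℕ) : ℝ)
  set K : ℝ := 42 + c * ((Fintype.card (Fin (2 * k - 1))).choose (k + 1) : ℕ) * (1 + 8 * c ^ 2) with hK
  have hK0 : 0 ≤ K := by positivity
  set p : ℝ := ((2 * k - 1 : ℕ) : ℝ) / k with hp
  have hJ := (condorcetConstant_pos hk).le
  refine ⟨K * (1 / (4 * c)) ^ (-p) * condorcetConstant k + C, by positivity, fun n hn => ?_⟩
  have hn0 : (0 : ℝ) < n := by positivity
  have ht : 0 < n / (4 * c) := by positivity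
  have hsub : Set.Icc (0 : Fin (2 * k - 1) → ℝ) 1 ⊆ Set.Ici 0 := fun x hx => hx.1
  have hint := integrableOn_exp_elemSymm hk hn0
  have hint' := integrableOn_exp_elemSymm hk ht
  have hq : IntegrableOn (fun x : Fin (2 * k - 1) → ℝ => (1 - probLE k x) ^ (n - 1))
      (Set.Icc 0 1) volume := by
    have : IsFiniteMeasure (volume.restrict (Set.Icc (0 : Fin (2 * k - 1) → ℝ) 1)) :=
      ⟨by simp [Real.volume_Icc_pi]⟩
    refine Integrable.of_bound (C := 1)
      (((measurable_probLE k).const_sub 1).pow_const _).aestronglyMeasurable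
      (Filter.Eventually.of_forall fun x => ?_)
    have h0 := probLE_nonneg k x
    have h1 := probLE_le_one k x
    rw [Real.norm_of_nonneg (pow_nonneg (by linarith) _)]
    exact pow_le_one₀ (by linarith) (by linarith)
  have hsplit := setIntegral_sdiff measurableSet_Icc hint hsub
  have h1 : |∫ x in Set.Icc (0 : Fin (2 * k - 1) → ℝ) 1,
      ((1 - probLE k x) ^ (n - 1) - Real.exp (-(n * elemSymm k x)))| ≤
      K * (1 / (4 * c)) ^ (-p) * condorcetConstant k / (n : ℝ) ^ 2 := by
    calc _ ≤ ∫ x in Set.Icc (0 : Fin (2 * k - 1) → ℝ) 1, K * (n : ℝ) ^ (-(1 / (k : ℝ))) *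
            Real.exp (-(n / (4 * c) * elemSymm k x)) := by
          rw [← Real.norm_eq_abs]
          refine norm_integral_le_of_norm_le ((hint'.mono_set hsub).const_mul _) ?_
          exact (ae_restrict_iff' measurableSet_Icc).2
            (Filter.Eventually.of_forall fun x hx => hpt n hn x hx)
      _ ≤ K * (n : ℝ) ^ (-(1 / (k : ℝ))) * ∫ x in Set.Ici (0 : Fin (2 * k - 1) → ℝ),
            Real.exp (-(n / (4 * c) * elemSymm k x)) := by
          rw [integral_const_mul]
          refine mul_le_mul_of_nonneg_left ?_ (by positivity)
          exact setIntegral_mono_set hint'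
            (Filter.Eventually.of_forall fun x => Real.exp_nonneg _)
            (LE.le.eventuallyLE hsub)
      _ = _ := by
          -- The pointwise gain `1/k` and the scaling exponent `(2k - 1)/k` add up to exactly `2`.
          have hpow : (n : ℝ) ^ (-(1 / (k : ℝ))) * (n : ℝ) ^ (-p) = ((n : ℝ) ^ 2)⁻¹ := by
            rw [← Real.rpow_add hn0, ← Real.rpow_natCast, ← Real.rpow_neg hn0.le, hp,
              Nat.cast_sub (by omega)]
            congr 1
            push_cast
            field_simp
            ring
          rw [setIntegral_exp_elemSymm_eq hk ht, ← hp, div_eq_mul_one_div (n : ℝ) (4 * c),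
            Real.mul_rpow hn0.le (by positivity), div_eq_mul_inv _ ((n : ℝ) ^ 2), ← hpow]
          ring
  have h2 := htail n hn0
  have h3 : 0 ≤ ∫ x in Set.Ici (0 : Fin (2 * k - 1) → ℝ) \ Set.Icc 0 1,
      Real.exp (-(n * elemSymm k x)) := integral_nonneg fun x => Real.exp_nonneg _
  rw [integral_sub hq (hint.mono_set hsub)] at h1
  rw [add_div]
  rw [abs_le] at h1 ⊢
  constructor <;> linarith [h1.1, h1.2]

theorem theorem1 (k : ℕ) (hk : 1 ≤ k) :
    IntegrableOn (expNegEsymm k) (nonnegOrthant k) volume ∧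
    0 < condorcetConstant k ∧
    ∃ D : ℝ, 0 < D ∧ ∀ (S : Type*) [Fintype S] (n : ℕ), Fintype.card S = n → 2 ≤ n →
      |(impartialCulture k S).real {r | ∃ A : S, IsCondorcetWinner k r A}
          - condorcetConstant k * (n : ℝ) ^ (-((k : ℝ) - 1) / (k : ℝ))|
        ≤ D * (Real.log n ^ (1 / (k : ℝ)) / n) := by
  refine ⟨integrableOn_expNegEsymm hk, condorcetConstant_pos hk, ?_⟩
  obtain ⟨M, hM, h⟩ := exists_abs_setIntegral_one_sub_probLE_pow_sub_le hk
  have hlog2 : 0 < Real.log 2 := Real.log_pos one_lt_two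
  have hL : 0 < Real.log 2 ^ (1 / (k : ℝ)) := Real.rpow_pos_of_pos hlog2 _
  -- The error obtained is `M / n`; as `n ≥ 2`, the factor `(log n / log 2)^(1/k)` is at least `1`
  -- and can be inserted. `M + 1` makes the constant positive.
  refine ⟨(M + 1) / Real.log 2 ^ (1 / (k : ℝ)), by positivity, fun S _ n hS hn => ?_⟩
  have hn0 : (0 : ℝ) < n := by positivity
  have hk0 : (k : ℝ) ≠ 0 := by positivity
  have hpow : (n : ℝ) ^ (-((k : ℝ) - 1) / (k : ℝ))
      = n * (n : ℝ) ^ (-(((2 * k - 1 : ℕ) : ℝ) / k)) := by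
    nth_rewrite 2 [← Real.rpow_one (n : ℝ)]
    rw [← Real.rpow_add hn0, Nat.cast_sub (by omega)]
    congr 1
    push_cast
    field_simp
    ring
  rw [impartialCulture_exists_isCondorcetWinner hk, hS, hpow, mul_left_comm,
    mul_comm (condorcetConstant k), ← setIntegral_exp_elemSymm_eq hk hn0, ← mul_sub, abs_mul,
    abs_of_pos hn0]
  calc _ ≤ n * (M / (n : ℝ) ^ 2) := mul_le_mul_of_nonneg_left (h n hn) hn0.le
    _ = M * (1 / n) := by field_simp
    _ ≤ (M + 1) * ((Real.log n / Real.log 2) ^ (1 / (k : ℝ)) / n) := by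
        have : 1 ≤ (Real.log n / Real.log 2) ^ (1 / (k : ℝ)) := by
          refine Real.one_le_rpow ?_ (by positivity)
          rw [one_le_div hlog2]
          exact Real.log_le_log two_pos (by exact_mod_cast hn)
        gcongr
        linarith
    _ = _ := by
        rw [Real.div_rpow (Real.log_nonneg (by exact_mod_cast (by omega : 1 ≤ n))) hlog2.le]
        field_simp
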